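/- Call a topological space locally compact if each of its points has a neighbourhood that is quasi-compact and Hausdorff in the subspace topology (the space itself need not be Hausdorff). Let $X$ be a path connected, locally path connected topological space that is semilocally simply connected, i.e. each $x\in X$ has a neighbourhood $V$ for which the homomorphism $\pi_1(V,x)\to\pi_1(X,x)$ induced by the inclusion is trivial. Let $p\colon\tilde X\to X$ be a simply connected covering space of $X$ (such a covering exists). Let $\Pi_1(X)$ be the fundamental groupoid of $X$, that is, the set of all paths $C([0,1],X)$ modulo endpoint fixing homotopy, with the quotient of the compact-open topology. Consider the statements 1. $X$ is locally compact; 2. $\tilde X$ is locally compact; 3. $\Pi_1(X)$ is locally compact. Then (1) and (2) are equivalent, and (3) implies both (1) and (2). If $X$ is also Hausdorff, then (1), (2) and (3) are equivalent, and they are moreover equivalent to: $\Pi_1(X)$ is locally compact and its space of units (the classes of the constant paths, with the subspace topology) is Hausdorff. -/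

import Mathlib

open Topology unitInterval

/-- Local compactness for spaces that need not be Hausdorff: every point has a
neighbourhood which is quasi-compact and Hausdorff (in the subspace topology). -/
def IsLocallyCompact (X : Type*) [TopologicalSpace X] : Prop :=
  ∀ x : X, ∃ K ∈ 𝓝 x, IsCompact K ∧ T2Space K

/-- A set `V` is relatively inessential in `X` at `x ∈ V` if the homomorphism
`π₁(V, x) → π₁(X, x)` induced by the inclusion is trivial. -/
def IsRelativelyInessentialAt {X : Type*} [TopologicalSpace X] (V : Set X) (x : V) : Prop :=
  ∀ γ : FundamentalGroup V x,
    FundamentalGroup.map (⟨Subtype.val, continuous_subtype_val⟩ : C(V, X)) x γ = 1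

/-- Every point `x` has a neighbourhood `V` such that `π₁(V, x) → π₁(X, x)` is trivial. -/
def IsSemilocallySimplyConnected (X : Type*) [TopologicalSpace X] : Prop :=
  ∀ x : X, ∃ V : Set X, ∃ hV : V ∈ 𝓝 x, IsRelativelyInessentialAt V ⟨x, mem_of_mem_nhds hV⟩

/-- Endpoint fixing homotopy on the space of paths `C([0,1], X)`. -/
def pathHomotopySetoid (X : Type*) [TopologicalSpace X] : Setoid C(I, X) where
  r γ η := γ.HomotopicRel η {0, 1}
  iseqv := ContinuousMap.HomotopicRel.equivalence

/-- The set of arrows of the fundamental groupoid `Π₁(X)`: all paths in `X`, with arbitrary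
endpoints, modulo endpoint fixing homotopy. -/
def FundGpd (X : Type*) [TopologicalSpace X] : Type _ := Quotient (pathHomotopySetoid X)

/-- `Π₁(X)` carries the quotient of the compact-open topology on `C([0,1], X)`. -/
instance FundGpd.instTopologicalSpace (X : Type*) [TopologicalSpace X] :
    TopologicalSpace (FundGpd X) :=
  inferInstanceAs (TopologicalSpace (Quotient (pathHomotopySetoid X)))

/-- The homotopy class of a path. -/
def FundGpd.mk {X : Type*} [TopologicalSpace X] (γ : C(I, X)) : FundGpd X :=
  Quotient.mk (pathHomotopySetoid X) γ

/-- The units of `Π₁(X)`: the classes of the constant paths. -/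
def FundGpd.units (X : Type*) [TopologicalSpace X] : Set (FundGpd X) :=
  Set.range fun x : X => FundGpd.mk (ContinuousMap.const I x)

/-!
The theorem rests on two constructions, neither of which needs `X` to be Hausdorff.

* The units map `x ↦ [const x]` and the source map present `X` as a retract of `Π₁(X)`, and retracts
  of locally compact spaces are locally compact (`IsLocallyCompact.of_leftInverse`).
* The map `(source, target) : Π₁(X) → X × X` is a local homeomorphism
  (`FundGpd.isLocalHomeomorph_endpoints`), and local compactness ascends along local homeomorphisms.

The second point has three ingredients. Continuity is clear. Openness holds because a path may be
prolonged by short paths at both ends: the result is a small change, in the compact-open topology,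
of the given path with constant paths appended (`FundGpd.exists_nhds_trans_mem`). Local injectivity
uses the sets `FundGpd.basicNhd α U V` of arrows that differ from `α` by classes of paths in `U` and
`V` at the two ends. For inessential `U` and `V` such an arrow is determined by its endpoints, and
for open `U` and `V` the set is open because a path close to `f` is homotopic to `f` up to short
paths at the ends (`isStableOn_zero_one`); the latter is proved by subdividing `[0, 1]` so that `f`
maps each piece into an inessential set.

Finally a covering map onto a path connected space is a surjective local homeomorphism, so local
compactness passes both ways between `X` and its simply connected covering.
-/

open CategoryTheory

/-! ### Locally compact spaces -/

/-- In a locally compact space the compact Hausdorff neighbourhoods of a point form a basis: a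
single compact Hausdorff neighbourhood is locally compact in the sense of Mathlib. -/
theorem IsLocallyCompact.exists_isCompact_t2Space_subset {A : Type*} [TopologicalSpace A]
    (hA : IsLocallyCompact A) {a : A} {U : Set A} (hU : U ∈ 𝓝 a) :
    ∃ K ∈ 𝓝 a, K ⊆ U ∧ IsCompact K ∧ T2Space K := by
  obtain ⟨K, hK, hKc, hKt⟩ := hA a
  have := isCompact_iff_compactSpace.mp hKc
  obtain ⟨L, hL, hLU, hLc⟩ := LocallyCompactSpace.local_compact_nhds
    (⟨a, mem_of_mem_nhds hK⟩ : K) (Subtype.val ⁻¹' U) (continuous_subtype_val.continuousAt hU)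
  refine ⟨Subtype.val '' L, ?_, by simpa using hLU, hLc.image continuous_subtype_val, ?_⟩
  · rw [← map_nhds_subtype_coe_eq_nhds (mem_of_mem_nhds hK) hK]
    exact Filter.image_mem_map hL
  · have hsub : Subtype.val '' L ⊆ K := by simp
    exact T2Space.of_injective_continuous (Set.inclusion_injective hsub)
      (continuous_inclusion hsub)

theorem IsLocallyCompact.prod {A B : Type*} [TopologicalSpace A] [TopologicalSpace B]
    (hA : IsLocallyCompact A) (hB : IsLocallyCompact B) : IsLocallyCompact (A × B) := by
  rintro ⟨a, b⟩
  obtain ⟨K, hK, hKc, hKt⟩ := hA a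
  obtain ⟨L, hL, hLc, hLt⟩ := hB b
  refine ⟨K ×ˢ L, prod_mem_nhds hK hL, hKc.prod hLc, ?_⟩
  exact T2Space.of_injective_continuous (Y := K × L) (f := Homeomorph.Set.prod K L)
    (Homeomorph.injective _) (Homeomorph.continuous _)

/-- A retract of a locally compact space is locally compact. No separation is assumed, so the
retract need not be closed; but it is closed in a Hausdorff neighbourhood of each of its points,
because there it is the locus where the identity and the retraction agree. -/
theorem IsLocallyCompact.of_leftInverse {A B : Type*} [TopologicalSpace A] [TopologicalSpace B]
    (hA : IsLocallyCompact A) {s : A → B} {u : B → A} (hs : Continuous s) (hu : Continuous u)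
    (h : Function.LeftInverse s u) : IsLocallyCompact B := by
  intro x
  obtain ⟨K, hK, -, hKt⟩ := hA (u x)
  have hr : (fun a => u (s a)) ⁻¹' K ∈ 𝓝 (u x) :=
    (hu.comp hs).continuousAt (by simpa [h x] using hK)
  obtain ⟨L, hL, hLsub, hLc, hLt⟩ :=
    hA.exists_isCompact_t2Space_subset (Filter.inter_mem hK hr)
  -- Both the inclusion and the retraction map `L` into the Hausdorff set `K`.
  let i : L → K := fun a => ⟨a, (hLsub a.2).1⟩
  let r : L → K := fun a => ⟨u (s a), (hLsub a.2).2⟩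
  have hi : Continuous i := by fun_prop
  have hr' : Continuous r := by fun_prop
  have hcl : IsClosed {a | i a = r a} := isClosed_eq hi hr'
  have := isCompact_iff_compactSpace.mp hLc
  have himg : u ⁻¹' L = (fun a : L => s a) '' {a | i a = r a} := by
    ext z
    constructor
    · intro hz
      exact ⟨⟨u z, hz⟩, Subtype.ext (congrArg u (h z)).symm, h z⟩
    · rintro ⟨a, ha, rfl⟩
      have ha' : (a : A) = u (s a) := congrArg Subtype.val ha
      simpa only [Set.mem_preimage, ← ha'] using a.2
  refine ⟨u ⁻¹' L, hu.continuousAt hL, ?_, ?_⟩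
  · rw [himg]
    exact hcl.isCompact.image (by fun_prop)
  · exact T2Space.of_injective_continuous (Y := L) (f := fun z : u ⁻¹' L => ⟨u z, z.2⟩)
      (fun z w hzw => Subtype.ext (h.injective (congrArg Subtype.val hzw))) (by fun_prop)

theorem OpenPartialHomeomorph.exists_isCompact_t2Space {A B : Type*} [TopologicalSpace A]
    [TopologicalSpace B] (e : OpenPartialHomeomorph A B) (hA : IsLocallyCompact A) {a : A}
    (ha : a ∈ e.source) : ∃ K ∈ 𝓝 (e a), IsCompact K ∧ T2Space K := by
  obtain ⟨K, hK, hKs, hKc, hKt⟩ :=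
    hA.exists_isCompact_t2Space_subset (e.open_source.mem_nhds ha)
  refine ⟨e '' K, e.image_mem_nhds ha hK, hKc.image_of_continuousOn (e.continuousOn.mono hKs), ?_⟩
  have hmaps : Set.MapsTo e.symm (e '' K) K := by
    rintro _ ⟨k, hk, rfl⟩
    rwa [e.left_inv (hKs hk)]
  have hsub : e '' K ⊆ e.target := by
    rintro _ ⟨k, hk, rfl⟩
    exact e.map_source (hKs hk)
  exact T2Space.of_injective_continuous (f := hmaps.restrict)
    ((hmaps.restrict_inj).mpr (e.symm.injOn.mono hsub))
    ((e.continuousOn_symm.mono hsub).mapsToRestrict hmaps)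

theorem IsLocalHomeomorph.isLocallyCompact_domain {A B : Type*} [TopologicalSpace A]
    [TopologicalSpace B] {f : A → B} (hf : IsLocalHomeomorph f) (hB : IsLocallyCompact B) :
    IsLocallyCompact A := by
  intro a
  obtain ⟨e, ha, -⟩ := hf a
  simpa [e.left_inv ha] using e.symm.exists_isCompact_t2Space hB (e.map_source ha)

theorem IsLocalHomeomorph.isLocallyCompact_codomain {A B : Type*} [TopologicalSpace A]
    [TopologicalSpace B] {f : A → B} (hf : IsLocalHomeomorph f) (hsurj : Function.Surjective f)
    (hA : IsLocallyCompact A) : IsLocallyCompact B := by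
  intro b
  obtain ⟨a, rfl⟩ := hsurj b
  obtain ⟨e, ha, rfl⟩ := hf a
  exact e.exists_isCompact_t2Space hA ha

theorem IsCoveringMap.surjective_of_pathConnectedSpace {A B : Type*} [TopologicalSpace A]
    [TopologicalSpace B] [PathConnectedSpace B] [Nonempty A] {p : A → B} (hp : IsCoveringMap p) :
    Function.Surjective p := by
  intro b
  obtain ⟨a⟩ := ‹Nonempty A›
  let γ : Path (p a) b := PathConnectedSpace.somePath _ _
  exact ⟨hp.liftPath γ a γ.source 1,
    (congrFun (hp.liftPath_lifts γ a γ.source) 1).trans γ.target⟩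

/-! ### Short paths and inessential sets -/

/-- A homotopy class of paths is represented within `U` if some path in it stays inside `U`. -/
def IsRepresentedIn {X : Type*} [TopologicalSpace X] (U : Set X) {x y : X}
    (α : FundamentalGroupoid.mk x ⟶ FundamentalGroupoid.mk y) : Prop :=
  ∃ p : Path x y, (∀ t, p t ∈ U) ∧ Path.Homotopic.Quotient.mk p = α

/-- A set is inessential if any two paths inside it with common endpoints are homotopic in the
ambient space, relative to their endpoints. -/
def IsInessential {X : Type*} [TopologicalSpace X] (W : Set X) : Prop :=
  ∀ ⦃x y : X⦄ (p q : Path x y), (∀ t, p t ∈ W) → (∀ t, q t ∈ W) → p.Homotopic q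

section

variable {X : Type*} [TopologicalSpace X]

theorem IsRepresentedIn.mono {U V : Set X} (hUV : U ⊆ V) {x y : X}
    {α : FundamentalGroupoid.mk x ⟶ FundamentalGroupoid.mk y} (h : IsRepresentedIn U α) :
    IsRepresentedIn V α := by
  obtain ⟨p, hp, rfl⟩ := h
  exact ⟨p, fun t => hUV (hp t), rfl⟩

theorem IsRepresentedIn.comp {U : Set X} {x y z : X}
    {α : FundamentalGroupoid.mk x ⟶ FundamentalGroupoid.mk y}
    {β : FundamentalGroupoid.mk y ⟶ FundamentalGroupoid.mk z} (hα : IsRepresentedIn U α)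
    (hβ : IsRepresentedIn U β) : IsRepresentedIn U (α ≫ β) := by
  obtain ⟨p, hp, rfl⟩ := hα
  obtain ⟨q, hq, rfl⟩ := hβ
  refine ⟨p.trans q, fun t => ?_, rfl⟩
  have : p.trans q t ∈ Set.range (p.trans q) := ⟨t, rfl⟩
  rw [Path.trans_range] at this
  rcases this with ⟨s, hs⟩ | ⟨s, hs⟩
  · exact hs ▸ hp s
  · exact hs ▸ hq s

theorem IsRepresentedIn.id {U : Set X} {x : X} (hx : x ∈ U) :
    IsRepresentedIn U (𝟙 (FundamentalGroupoid.mk x)) :=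
  ⟨Path.refl x, fun _ => hx, rfl⟩

theorem IsRepresentedIn.target_mem {U : Set X} {x y : X}
    {α : FundamentalGroupoid.mk x ⟶ FundamentalGroupoid.mk y} (h : IsRepresentedIn U α) :
    y ∈ U := by
  obtain ⟨p, hp, -⟩ := h
  simpa using hp 1

theorem IsInessential.arrow_eq {W : Set X} (hW : IsInessential W) {x y : X}
    {α β : FundamentalGroupoid.mk x ⟶ FundamentalGroupoid.mk y} (hα : IsRepresentedIn W α)
    (hβ : IsRepresentedIn W β) : α = β := by
  obtain ⟨p, hp, rfl⟩ := hα
  obtain ⟨q, hq, rfl⟩ := hβ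
  exact Path.Homotopic.Quotient.eq.mpr (hW p q hp hq)

theorem eventually_exists_path_mem [LocallyPathConnectedSpace X] {x : X} {U : Set X}
    (hU : U ∈ 𝓝 x) : ∀ᶠ y in 𝓝 x, ∃ p : Path x y, ∀ t, p t ∈ U := by
  filter_upwards [pathComponentIn_mem_nhds hU] with y hy
  exact ⟨hy.somePath, hy.somePath_mem⟩

theorem eventually_exists_isRepresentedIn [LocallyPathConnectedSpace X] {x : X} {U : Set X}
    (hU : U ∈ 𝓝 x) : ∀ᶠ y in 𝓝 x,
      ∃ α : FundamentalGroupoid.mk x ⟶ FundamentalGroupoid.mk y, IsRepresentedIn U α :=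
  (eventually_exists_path_mem hU).mono fun _ ⟨p, hp⟩ => ⟨Path.Homotopic.Quotient.mk p, p, hp, rfl⟩

theorem IsRelativelyInessentialAt.homotopic_refl {V : Set X} {x : V}
    (hV : IsRelativelyInessentialAt V x) (p : Path (x : X) x) (hp : ∀ t, p t ∈ V) :
    p.Homotopic (Path.refl _) := by
  let q : Path x x :=
    ⟨⟨fun t => ⟨p t, hp t⟩, by fun_prop⟩, Subtype.ext p.source, Subtype.ext p.target⟩
  exact Path.Homotopic.Quotient.exact (hV (Path.Homotopic.Quotient.mk q))

/-- The path component of the base point in a relatively inessential neighbourhood is inessential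
with respect to all of its points, not only the base point. -/
theorem IsSemilocallySimplyConnected.exists_isInessential [LocallyPathConnectedSpace X]
    (hX : IsSemilocallySimplyConnected X) (x : X) : ∃ W ∈ 𝓝 x, IsInessential W := by
  obtain ⟨V, hVx, hV⟩ := hX x
  refine ⟨pathComponentIn V x, pathComponentIn_mem_nhds hVx, fun a b p q hp hq => ?_⟩
  have ha : JoinedIn V x a := by
    have : a ∈ pathComponentIn V x := by simpa using hp 0
    exact this
  have hp' : ∀ t, p t ∈ V := fun t => pathComponentIn_subset (hp t)
  have hq' : ∀ t, q t ∈ V := fun t => pathComponentIn_subset (hq t)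
  let r := ha.somePath
  let ρ : FundamentalGroupoid.mk x ⟶ FundamentalGroupoid.mk a := Path.Homotopic.Quotient.mk r
  let α : FundamentalGroupoid.mk a ⟶ FundamentalGroupoid.mk b := Path.Homotopic.Quotient.mk p
  let β : FundamentalGroupoid.mk a ⟶ FundamentalGroupoid.mk b := Path.Homotopic.Quotient.mk q
  have hloop : IsRepresentedIn V (ρ ≫ (α ≫ Groupoid.inv β) ≫ Groupoid.inv ρ) :=
    .comp ⟨r, ha.somePath_mem, rfl⟩ <| .comp (.comp ⟨p, hp', rfl⟩
      ⟨q.symm, fun t => hq' _, rfl⟩) ⟨r.symm, fun t => ha.somePath_mem _, rfl⟩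
  obtain ⟨l, hl, hlρ⟩ := hloop
  have h1 : ρ ≫ (α ≫ Groupoid.inv β) ≫ Groupoid.inv ρ = 𝟙 _ := by
    rw [← hlρ]
    exact Path.Homotopic.Quotient.eq.mpr (hV.homotopic_refl l hl)
  have h2 : α = β := by
    rw [Groupoid.inv_eq_inv, Groupoid.inv_eq_inv, ← Category.assoc, IsIso.comp_inv_eq,
      Category.id_comp, ← Category.assoc, IsIso.comp_inv_eq] at h1
    exact (cancel_epi ρ).mp h1
  exact Path.Homotopic.Quotient.exact h2

/-! ### Paths close to a given path -/

instance contractibleSpace_unitInterval : ContractibleSpace I :=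
  (convex_Icc (0 : ℝ) 1).contractibleSpace ⟨0, by simp⟩

/-- The homotopy class of the restriction of `g` to the interval from `a` to `b`. It is the image
under `g` of the unique class of paths from `a` to `b` in `[0, 1]`, which makes concatenation of
restrictions an instance of functoriality. -/
noncomputable def pathSegment (g : C(I, X)) (a b : I) :
    FundamentalGroupoid.mk (g a) ⟶ FundamentalGroupoid.mk (g b) :=
  (FundamentalGroupoid.map g).map (X := .mk a) (Y := .mk b)
    (Path.Homotopic.Quotient.mk (PathConnectedSpace.somePath a b))

theorem pathSegment_eq_mk_map (g : C(I, X)) {a b : I} (p : Path a b) :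
    pathSegment g a b = Path.Homotopic.Quotient.mk (p.map g.continuous) :=
  congrArg (fun q => (FundamentalGroupoid.map g).map (X := .mk a) (Y := .mk b) q)
    (Subsingleton.elim _ (Path.Homotopic.Quotient.mk p))

theorem pathSegment_comp_pathSegment (g : C(I, X)) (a b c : I) :
    pathSegment g a b ≫ pathSegment g b c = pathSegment g a c := by
  exact ((FundamentalGroupoid.map g).map_comp (X := .mk a) (Y := .mk b) (Z := .mk c) _ _).symm.trans
    (congrArg (fun q => (FundamentalGroupoid.map g).map (X := .mk a) (Y := .mk c) q)
      (Subsingleton.elim (α := Path.Homotopic.Quotient a c) _ _))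

theorem pathSegment_zero_one (g : C(I, X)) :
    pathSegment g 0 1 = Path.Homotopic.Quotient.mk (⟨g, rfl, rfl⟩ : Path (g 0) (g 1)) :=
  pathSegment_eq_mk_map g (⟨.id I, rfl, rfl⟩ : Path (0 : I) 1)

theorem isRepresentedIn_pathSegment {U : Set X} {g : C(I, X)} {a b : I} (hab : a ≤ b)
    (h : Set.MapsTo g (Set.Icc a b) U) : IsRepresentedIn U (pathSegment g a b) := by
  let p : Path a b := (⟨.id I, rfl, rfl⟩ : Path (0 : I) 1).subpath a b
  have hp : ∀ t, p t ∈ Set.Icc a b := fun t => by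
    rw [← Set.image_id (Set.Icc a b)]
    exact (Path.range_subpath_of_le (⟨.id I, rfl, rfl⟩ : Path (0 : I) 1) a b hab).subset ⟨t, rfl⟩
  exact ⟨p.map g.continuous, fun t => h (hp t), (pathSegment_eq_mk_map g p).symm⟩

/-- Stability of `f` over the interval from `a` to `b`: up to homotopy, every path `g` close to `f`
differs there from `f` only by classes of arbitrarily short paths from `f a` to `g a` and from `f b`
to `g b`. -/
def IsStableOn (f : C(I, X)) (a b : I) : Prop :=
  ∀ U ∈ 𝓝 (f a), ∀ V ∈ 𝓝 (f b), ∀ᶠ g : C(I, X) in 𝓝 f,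
    ∃ (δ : FundamentalGroupoid.mk (f a) ⟶ FundamentalGroupoid.mk (g a))
      (η : FundamentalGroupoid.mk (f b) ⟶ FundamentalGroupoid.mk (g b)),
      IsRepresentedIn U δ ∧ IsRepresentedIn V η ∧ δ ≫ pathSegment g a b = pathSegment f a b ≫ η

theorem IsStableOn.trans [LocallyPathConnectedSpace X] (hX : IsSemilocallySimplyConnected X)
    {f : C(I, X)} {a b c : I} (hab : IsStableOn f a b) (hbc : IsStableOn f b c) :
    IsStableOn f a c := by
  intro U hU V hV
  obtain ⟨W, hWb, hW⟩ := hX.exists_isInessential (f b)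
  filter_upwards [hab U hU W hWb, hbc W hWb V hV] with g ⟨δ, η, hδ, hη, h⟩ ⟨δ', η', hδ', hη', h'⟩
  -- The two short paths from `f b` to `g b` are homotopic, so they cancel in the concatenation.
  obtain rfl := hW.arrow_eq hη hδ'
  refine ⟨δ, η', hδ, hη', ?_⟩
  rw [← pathSegment_comp_pathSegment g a b c, ← pathSegment_comp_pathSegment f a b c, ← Category.assoc, h,
    Category.assoc, h', Category.assoc]

theorem isStableOn_of_mapsTo [LocallyPathConnectedSpace X] {f : C(I, X)} {a b : I} (hab : a ≤ b)
    {W : Set X} (hW : IsInessential W) (hf : Set.MapsTo f (Set.Icc a b) (interior W)) :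
    IsStableOn f a b := by
  intro U hU V hV
  have haW : W ∈ 𝓝 (f a) := mem_interior_iff_mem_nhds.mp (hf (Set.left_mem_Icc.mpr hab))
  have hbW : W ∈ 𝓝 (f b) := mem_interior_iff_mem_nhds.mp (hf (Set.right_mem_Icc.mpr hab))
  have hev (t : I) : Filter.Tendsto (fun g : C(I, X) => g t) (𝓝 f) (𝓝 (f t)) :=
    (continuous_eval_const t).continuousAt
  filter_upwards [ContinuousMap.eventually_mapsTo isCompact_Icc isOpen_interior hf,
    (hev a).eventually (eventually_exists_isRepresentedIn (Filter.inter_mem hU haW)),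
    (hev b).eventually (eventually_exists_isRepresentedIn (Filter.inter_mem hV hbW))]
    with g hg ⟨δ, hδ⟩ ⟨η, hη⟩
  -- Both composites from `f a` to `g b` run inside `W`.
  refine ⟨δ, η, hδ.mono Set.inter_subset_left, hη.mono Set.inter_subset_left, hW.arrow_eq ?_ ?_⟩
  · exact (hδ.mono Set.inter_subset_right).comp
      (isRepresentedIn_pathSegment hab (hg.mono_right interior_subset))
  · exact (isRepresentedIn_pathSegment hab (hf.mono_right interior_subset)).comp
      (hη.mono Set.inter_subset_right)

theorem isStableOn_zero_one [LocallyPathConnectedSpace X] (hX : IsSemilocallySimplyConnected X)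
    (f : C(I, X)) : IsStableOn f 0 1 := by
  choose W hWx hW using hX.exists_isInessential
  obtain ⟨t, ht0, htm, ⟨n, hn⟩, ht⟩ := exists_monotone_Icc_subset_open_cover_unitInterval
    (c := fun x => f ⁻¹' interior (W x)) (fun x => isOpen_interior.preimage f.continuous)
    (fun s _ => Set.mem_iUnion.mpr ⟨f s, mem_interior_iff_mem_nhds.mpr (hWx (f s))⟩)
  have key : ∀ m, IsStableOn f (t 0) (t (m + 1)) := by
    intro m
    induction m with
    | zero =>
      obtain ⟨x, hx⟩ := ht 0
      exact isStableOn_of_mapsTo (htm (Nat.le_succ 0)) (hW x) hx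
    | succ m ih =>
      obtain ⟨x, hx⟩ := ht (m + 1)
      exact ih.trans hX (isStableOn_of_mapsTo (htm (Nat.le_succ _)) (hW x) hx)
  simpa only [ht0, hn (n + 1) (Nat.le_succ n)] using key n

end

/-! ### The topology of the fundamental groupoid -/

namespace FundGpd

variable {X : Type*} [TopologicalSpace X]

/-- The source and the target of an arrow. -/
def endpoints : FundGpd X → X × X :=
  Quotient.lift (fun γ : C(I, X) => (γ 0, γ 1)) fun _ _ ⟨H⟩ =>
    Prod.ext (H.fst_eq_snd (by simp)) (H.fst_eq_snd (by simp))

theorem isQuotientMap_mk : IsQuotientMap (mk : C(I, X) → FundGpd X) :=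
  isQuotientMap_quotient_mk'

theorem continuous_endpoints : Continuous (endpoints : FundGpd X → X × X) :=
  isQuotientMap_mk.continuous_iff.mpr <|
    (continuous_eval_const 0).prodMk (continuous_eval_const 1)

theorem continuous_mk_const : Continuous fun x : X => mk (ContinuousMap.const I x) :=
  isQuotientMap_mk.continuous.comp ContinuousMap.continuous_const'

/-- An arrow of the algebraic fundamental groupoid, regarded as a point of `Π₁(X)`. -/
def ofHom {x y : X} (α : FundamentalGroupoid.mk x ⟶ FundamentalGroupoid.mk y) : FundGpd X :=
  Quotient.lift (s := Path.Homotopic.setoid x y) (fun p => mk p.toContinuousMap)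
    (fun _ _ h => Quotient.sound h) α

theorem ofHom_injective {x y : X} : Function.Injective (ofHom (x := x) (y := y)) := by
  intro α β h
  obtain ⟨p, rfl⟩ := Path.Homotopic.Quotient.mk_surjective α
  obtain ⟨q, rfl⟩ := Path.Homotopic.Quotient.mk_surjective β
  exact Path.Homotopic.Quotient.eq.mpr (Quotient.exact h)

theorem endpoints_ofHom {x y : X} (α : FundamentalGroupoid.mk x ⟶ FundamentalGroupoid.mk y) :
    endpoints (ofHom α) = (x, y) := by
  obtain ⟨p, rfl⟩ := Path.Homotopic.Quotient.mk_surjective α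
  exact Prod.ext p.source p.target

theorem mk_eq_ofHom_pathSegment (g : C(I, X)) : mk g = ofHom (pathSegment g 0 1) := by
  rw [pathSegment_zero_one]
  rfl

/-- The basic neighbourhoods of an arrow `α`: the arrows obtained from `α` by composing at the two
ends with classes of paths inside `U` and `V`. -/
def basicNhd {x y : X} (α : FundamentalGroupoid.mk x ⟶ FundamentalGroupoid.mk y) (U V : Set X) :
    Set (FundGpd X) :=
  {c | ∃ (x' y' : X) (α' : FundamentalGroupoid.mk x' ⟶ FundamentalGroupoid.mk y'), c = ofHom α' ∧
    ∃ (δ : FundamentalGroupoid.mk x ⟶ FundamentalGroupoid.mk x')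
      (η : FundamentalGroupoid.mk y ⟶ FundamentalGroupoid.mk y'),
      IsRepresentedIn U δ ∧ IsRepresentedIn V η ∧ δ ≫ α' = α ≫ η}

theorem ofHom_mem_basicNhd {x y : X} (α : FundamentalGroupoid.mk x ⟶ FundamentalGroupoid.mk y)
    {U V : Set X} (hx : x ∈ U) (hy : y ∈ V) : ofHom α ∈ basicNhd α U V :=
  ⟨x, y, α, rfl, 𝟙 _, 𝟙 _, .id hx, .id hy, by simp⟩

theorem isOpen_basicNhd [LocallyPathConnectedSpace X] (hX : IsSemilocallySimplyConnected X)
    {x y : X} (α : FundamentalGroupoid.mk x ⟶ FundamentalGroupoid.mk y) {U V : Set X}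
    (hU : IsOpen U) (hV : IsOpen V) : IsOpen (basicNhd α U V) := by
  rw [← isQuotientMap_mk.isOpen_preimage, isOpen_iff_mem_nhds]
  rintro g ⟨x', y', α', hg, δ, η, hδ, hη, h⟩
  have hend := congrArg endpoints ((mk_eq_ofHom_pathSegment g).symm.trans hg)
  rw [endpoints_ofHom, endpoints_ofHom, Prod.mk.injEq] at hend
  obtain ⟨rfl, rfl⟩ := hend
  obtain rfl := ofHom_injective ((mk_eq_ofHom_pathSegment g).symm.trans hg)
  filter_upwards [isStableOn_zero_one hX g U (hU.mem_nhds hδ.target_mem)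
    V (hV.mem_nhds hη.target_mem)] with g' ⟨δ', η', hδ', hη', h'⟩
  refine ⟨_, _, _, mk_eq_ofHom_pathSegment g', δ ≫ δ', η ≫ η', hδ.comp hδ', hη.comp hη', ?_⟩
  rw [Category.assoc, h', ← Category.assoc, h, Category.assoc]

theorem injOn_endpoints_basicNhd {x y : X}
    (α : FundamentalGroupoid.mk x ⟶ FundamentalGroupoid.mk y) {U V : Set X}
    (hU : IsInessential U) (hV : IsInessential V) : Set.InjOn endpoints (basicNhd α U V) := by
  rintro _ ⟨x₁, y₁, α₁, rfl, δ₁, η₁, hδ₁, hη₁, h₁⟩ _ ⟨x₂, y₂, α₂, rfl, δ₂, η₂, hδ₂, hη₂, h₂⟩ h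
  rw [endpoints_ofHom, endpoints_ofHom, Prod.mk.injEq] at h
  obtain ⟨rfl, rfl⟩ := h
  obtain rfl := hU.arrow_eq hδ₁ hδ₂
  obtain rfl := hV.arrow_eq hη₁ hη₂
  rw [(cancel_epi δ₁).mp (h₁.trans h₂.symm)]

/-- For the compact-open topology, every path that stays close enough to a point `x` is close to the
constant path at `x`. -/
theorem exists_nhds_forall_mem_of_mem_nhds_const {x : X} {O : Set C(I, X)}
    (hO : O ∈ 𝓝 (ContinuousMap.const I x)) :
    ∃ U ∈ 𝓝 x, ∀ γ : C(I, X), (∀ t, γ t ∈ U) → γ ∈ O := by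
  have htend : Filter.Tendsto id
      (Filter.comap (fun γ : C(I, X) => Set.range γ) (𝓝 x).smallSets)
      (𝓝 (ContinuousMap.const I x)) := by
    rw [ContinuousMap.tendsto_nhds_compactOpen]
    intro K _ U hU hKU
    rcases K.eq_empty_or_nonempty with rfl | ⟨k, hk⟩
    · exact Filter.Eventually.of_forall fun γ => Set.mapsTo_empty _ _
    · have hxU : U ∈ 𝓝 x := hU.mem_nhds (hKU hk)
      filter_upwards [Filter.preimage_mem_comap (Filter.eventually_smallSets.mpr
        ⟨U, hxU, fun _ h => h⟩)] with γ hγ t _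
      exact hγ ⟨t, rfl⟩
  obtain ⟨S, hS, hSO⟩ := Filter.mem_comap.mp (htend hO)
  obtain ⟨U, hU, hUS⟩ := Filter.eventually_smallSets.mp hS
  exact ⟨U, hU, fun γ hγ => hSO (hUS _ (Set.range_subset_iff.mpr hγ))⟩

/-- Prolonging a path at both ends by arbitrary paths that stay close to its endpoints does not
leave a given open set of arrows. Since `O` is a set of homotopy classes, the path may be replaced
by its concatenation with constant paths, which leaves room in the parameter for the additions. -/
theorem exists_nhds_trans_mem {x y : X} (p : Path x y) {O : Set (FundGpd X)} (hO : IsOpen O)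
    (hp : mk p.toContinuousMap ∈ O) : ∃ U ∈ 𝓝 x, ∃ V ∈ 𝓝 y,
      ∀ (x' y' : X) (α : Path x x') (β : Path y y'), (∀ t, α t ∈ U) → (∀ t, β t ∈ V) →
        mk (α.symm.trans (p.trans β)).toContinuousMap ∈ O := by
  -- The endpoints `x'` and `y'` vary, so pairs of paths are parametrised by a subspace of
  -- `C(I, X) × C(I, X)`, on which concatenation with `p` is continuous.
  let S : Set (C(I, X) × C(I, X)) := {s | s.1 0 = x ∧ s.2 0 = y}
  let l (s : S) : Path x (s.1.1 1) := ⟨s.1.1, s.2.1, rfl⟩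
  let r (s : S) : Path y (s.1.2 1) := ⟨s.1.2, s.2.2, rfl⟩
  have hl : Continuous ↿l := by
    change Continuous fun q : S × I => q.1.1.1 q.2
    fun_prop
  have hr : Continuous ↿r := by
    change Continuous fun q : S × I => q.1.1.2 q.2
    fun_prop
  have hp' : Continuous ↿(fun _ : S => p) := by
    change Continuous fun q : S × I => p q.2
    fun_prop
  have hglue : Continuous ↿(fun s => (l s).symm.trans (p.trans (r s))) :=
    Path.trans_continuous_family _ (Path.symm_continuous_family _ hl) _
      (Path.trans_continuous_family _ hp' _ hr)
  let G : C(S, C(I, X)) := ContinuousMap.curry ⟨_, hglue⟩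
  let s₀ : S := ⟨(ContinuousMap.const I x, ContinuousMap.const I y), rfl, rfl⟩
  have hG : mk (G s₀) = mk p.toContinuousMap := by
    have h1 : ((Path.refl x).symm.trans (p.trans (Path.refl y))).Homotopic p :=
      (Path.Homotopic.hcomp (.refl _) ⟨Path.Homotopy.transRefl p⟩).trans
        (by rw [Path.refl_symm]; exact ⟨Path.Homotopy.reflTrans p⟩)
    exact Quotient.sound h1
  have hnhds : (fun s => mk (G s)) ⁻¹' O ∈ 𝓝 s₀ :=
    (hO.preimage (isQuotientMap_mk.continuous.comp G.continuous)).mem_nhds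
      (show mk (G s₀) ∈ O from hG ▸ hp)
  obtain ⟨T, hT, hTO⟩ := mem_nhds_subtype _ _ _ |>.mp hnhds
  obtain ⟨T₁, hT₁, T₂, hT₂, hT₁₂⟩ := mem_nhds_prod_iff.mp hT
  obtain ⟨U, hU, hUT⟩ := exists_nhds_forall_mem_of_mem_nhds_const hT₁
  obtain ⟨V, hV, hVT⟩ := exists_nhds_forall_mem_of_mem_nhds_const hT₂
  refine ⟨U, hU, V, hV, fun x' y' α β hα hβ => ?_⟩
  exact hTO (show (⟨(α.toContinuousMap, β.toContinuousMap), α.source, β.source⟩ : S) ∈ _ from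
    hT₁₂ ⟨hUT _ hα, hVT _ hβ⟩)

theorem isOpenMap_endpoints [LocallyPathConnectedSpace X] :
    IsOpenMap (endpoints : FundGpd X → X × X) := by
  intro O hO
  rw [isOpen_iff_mem_nhds]
  rintro _ ⟨c, hc, rfl⟩
  obtain ⟨f, rfl⟩ := isQuotientMap_mk.surjective c
  obtain ⟨U, hU, V, hV, h⟩ := exists_nhds_trans_mem (⟨f, rfl, rfl⟩ : Path (f 0) (f 1)) hO hc
  filter_upwards [prod_mem_nhds (eventually_exists_path_mem hU) (eventually_exists_path_mem hV)]
    with ⟨x', y'⟩ ⟨⟨α, hα⟩, ⟨β, hβ⟩⟩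
  exact ⟨_, h x' y' α β hα hβ, Prod.ext (Path.source _) (Path.target _)⟩

/-- Source and target exhibit `Π₁(X)` as a space étale over `X × X`; no separation is needed. -/
theorem isLocalHomeomorph_endpoints [LocallyPathConnectedSpace X]
    (hX : IsSemilocallySimplyConnected X) :
    IsLocalHomeomorph (endpoints : FundGpd X → X × X) := by
  rw [isLocalHomeomorph_iff_isOpenEmbedding_restrict]
  intro c
  obtain ⟨f, rfl⟩ := isQuotientMap_mk.surjective c
  obtain ⟨U, hU, hUi⟩ := hX.exists_isInessential (f 0)
  obtain ⟨V, hV, hVi⟩ := hX.exists_isInessential (f 1)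
  have hopen := isOpen_basicNhd hX (pathSegment f 0 1) (isOpen_interior (s := U))
    (isOpen_interior (s := V))
  refine ⟨_, hopen.mem_nhds (mk_eq_ofHom_pathSegment f ▸ ofHom_mem_basicNhd (pathSegment f 0 1)
    (mem_interior_iff_mem_nhds.mpr hU) (mem_interior_iff_mem_nhds.mpr hV)), ?_⟩
  refine .of_continuous_injective_isOpenMap
    (continuous_endpoints.comp continuous_subtype_val) ?_
    (isOpenMap_endpoints.comp hopen.isOpenMap_subtype_val)
  exact ((injOn_endpoints_basicNhd _
    (fun _ _ p q hp hq => hUi p q (fun t => interior_subset (hp t))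
      (fun t => interior_subset (hq t)))
    (fun _ _ p q hp hq => hVi p q (fun t => interior_subset (hp t))
      (fun t => interior_subset (hq t))))).injective

/-- The units map embeds `X` in `Π₁(X)` as a retract, with the source map as retraction. -/
theorem isLocallyCompact_base (h : IsLocallyCompact (FundGpd X)) : IsLocallyCompact X :=
  h.of_leftInverse (continuous_fst.comp continuous_endpoints) continuous_mk_const fun _ => rfl

theorem isLocallyCompact_iff [LocallyPathConnectedSpace X] (hX : IsSemilocallySimplyConnected X) :
    IsLocallyCompact (FundGpd X) ↔ IsLocallyCompact X :=
  ⟨isLocallyCompact_base, fun h => (isLocalHomeomorph_endpoints hX).isLocallyCompact_domain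
    (h.prod h)⟩

theorem t2Space_units [T2Space X] : T2Space (units X) := by
  refine T2Space.of_injective_continuous (f := fun c : units X => (endpoints c.1).1) ?_
    (continuous_fst.comp (continuous_endpoints.comp continuous_subtype_val))
  rintro ⟨_, x, rfl⟩ ⟨_, y, rfl⟩ h
  obtain rfl : x = y := h
  rfl

end FundGpd

theorem mainTheorem7 {X : Type*} [TopologicalSpace X] [PathConnectedSpace X]
    [LocallyPathConnectedSpace X] (hX : IsSemilocallySimplyConnected X) :
    (IsLocallyCompact (FundGpd X) → IsLocallyCompact X) ∧
    (T2Space X → (IsLocallyCompact X ↔ IsLocallyCompact (FundGpd X))) ∧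
    (∀ (E : Type*) [TopologicalSpace E] [SimplyConnectedSpace E] (p : E → X),
      IsCoveringMap p →
        (IsLocallyCompact X ↔ IsLocallyCompact E) ∧
        (IsLocallyCompact (FundGpd X) → IsLocallyCompact E) ∧
        (T2Space X →
          [IsLocallyCompact X, IsLocallyCompact E, IsLocallyCompact (FundGpd X),
            IsLocallyCompact (FundGpd X) ∧ T2Space (FundGpd.units X)].TFAE)) := by
  have hPi := FundGpd.isLocallyCompact_iff hX
  refine ⟨hPi.mp, fun _ => hPi.symm, fun E _ _ p hp => ?_⟩
  have hE : IsLocallyCompact X ↔ IsLocallyCompact E :=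
    ⟨hp.isLocalHomeomorph.isLocallyCompact_domain,
      hp.isLocalHomeomorph.isLocallyCompact_codomain hp.surjective_of_pathConnectedSpace⟩
  refine ⟨hE, fun h => hE.mp (hPi.mp h), fun _ => ?_⟩
  tfae_have 1 ↔ 2 := hE
  tfae_have 1 ↔ 3 := hPi.symm
  tfae_have 3 ↔ 4 := ⟨fun h => ⟨h, FundGpd.t2Space_units⟩, And.left⟩
  tfae_finish
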